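/- Let $R$ be a commutative noetherian ring and let $M$ be an $R$-complex, that is, a (possibly unbounded) chain complex of $R$-modules. For any commutative ring $A$ let $E_A(-)$ denote the injective hull of an $A$-module, and for a commutative noetherian ring $A$ and an $A$-complex $X$ put $D_A(X)=\mathrm{Hom}_A\big(X,\bigoplus_{\mathfrak m\in\mathrm{Max}\,A}E_A(A/\mathfrak m)\big)$. For $\mathfrak p\in\mathrm{Spec}\,R$ let ${}^{\mathfrak p}M=D_{R_{\mathfrak p}}\big(D_R(M)_{\mathfrak p}\big)$ be the co-localization of $M$ at $\mathfrak p$, and define $$\mathrm{coSupp}_R M=\{\mathfrak p\in\mathrm{Spec}\,R \mid {}^{\mathfrak p}M\not\simeq 0\},\qquad \mathrm{cosupp}_R M=\{\mathfrak p\in\mathrm{Spec}\,R \mid \mathrm{RHom}_R(R/\mathfrak p,{}^{\mathfrak p}M)\not\simeq 0\},$$ where $X\simeq 0$ means that $X$ is zero in the derived category, i.e. that $X$ is acyclic. Then $$\mathrm{cosupp}_R M\subseteq\mathrm{coSupp}_R M .$$ Equality holds if $R$ is semi-local (it has only finitely many maximal ideals) and complete with respect to its Jacobson radical, every homology module $\mathrm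 H_n(M)$ is artinian, and $M$ is bounded above, i.e. $\mathrm H_n(M)=0$ for all $n\gg 0$. -/

import Mathlib

universe u

open CategoryTheory

namespace Cosupport

section InjectiveHull

variable {R : Type u} [CommRing R]

/-- `i : A → E` exhibits `E` as an injective hull of `A`: `E` is an injective module, `i` is
injective, and `i` is essential (every submodule of `E` that meets the image of `i` trivially
is zero). -/
structure IsInjectiveHull {A E : Type u} [AddCommGroup A] [Module R A] [AddCommGroup E]
    [Module R E] (i : A →ₗ[R] E) : Prop where
  injective_module : Module.Injective R E
  injective : Function.Injective i
  essential : ∀ N : Submodule R E, N ⊓ LinearMap.range i = ⊥ → N = ⊥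

/-- Every module has an injective hull. -/
theorem exists_isInjectiveHull (A : ModuleCat.{u} R) :
    ∃ (E : ModuleCat.{u} R) (i : A →ₗ[R] E), IsInjectiveHull i := by
  obtain ⟨⟨J, hJinj, ι, hι⟩⟩ := EnoughInjectives.presentation A
  have hJ : Module.Injective R J := Module.injective_module_of_injective_object R J
  set j : A →ₗ[R] J := ι.hom with hj
  have hjinj : Function.Injective j := (ModuleCat.mono_iff_injective ι).1 hι
  set B : Submodule R J := LinearMap.range j with hB
  -- a maximal essential extension of `B` inside `J`
  let S : Set (Submodule R J) := {N | B ≤ N ∧ ∀ K ≤ N, K ⊓ B = ⊥ → K = ⊥}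
  obtain ⟨E, hBE, hEmax⟩ : ∃ E, B ≤ E ∧ Maximal (· ∈ S) E := by
    refine zorn_le_nonempty₀ S ?_ B ⟨le_rfl, fun K hK h => ?_⟩
    · intro c hcS hc N hN
      refine ⟨sSup c, ⟨(hcS hN).1.trans (le_sSup hN), fun K hK hKB => ?_⟩,
        fun z hz => le_sSup hz⟩
      rw [eq_bot_iff]
      intro x hx
      obtain ⟨L, hL, hxL⟩ := (Submodule.mem_sSup_of_directed ⟨N, hN⟩ hc.directedOn).1 (hK hx)
      have h1 : Submodule.span R {x} = ⊥ := by
        refine (hcS hL).2 _ ((Submodule.span_singleton_le_iff_mem _ _).2 hxL) ?_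
        rw [eq_bot_iff, ← hKB]
        exact inf_le_inf_right _ ((Submodule.span_singleton_le_iff_mem _ _).2 hx)
      exact Submodule.span_singleton_eq_bot.1 h1
    · rwa [inf_eq_left.2 hK] at h
  -- a submodule of `J` maximal among those meeting `E` trivially
  let T : Set (Submodule R J) := {N | N ⊓ E = ⊥}
  obtain ⟨C, -, hCmax⟩ : ∃ C, (⊥ : Submodule R J) ≤ C ∧ Maximal (· ∈ T) C := by
    refine zorn_le_nonempty₀ T ?_ ⊥ (bot_inf_eq _)
    intro c hcT hc N hN
    refine ⟨sSup c, ?_, fun z hz => le_sSup hz⟩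
    change sSup c ⊓ E = ⊥
    rw [eq_bot_iff]
    rintro x ⟨hx, hxE⟩
    obtain ⟨L, hL, hxL⟩ := (Submodule.mem_sSup_of_directed ⟨N, hN⟩ hc.directedOn).1 hx
    rw [← (show L ⊓ E = ⊥ from hcT hL)]
    exact ⟨hxL, hxE⟩
  have hCE : C ⊓ E = ⊥ := hCmax.prop
  obtain ⟨g, hg⟩ := hJ.out (C.mkQ ∘ₗ E.subtype) (by
    rw [← LinearMap.ker_eq_bot, LinearMap.ker_eq_bot']
    intro x hx
    have h1 : (x : J) ∈ C := by simpa using hx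
    have h2 : (x : J) ∈ C ⊓ E := ⟨h1, x.2⟩
    rw [hCE] at h2
    exact Subtype.ext h2) E.subtype
  have hg' : ∀ x ∈ E, g (C.mkQ x) = x := fun x hx => hg ⟨x, hx⟩
  have hErange : E ≤ LinearMap.range g := fun x hx => ⟨_, hg' x hx⟩
  have hrange : LinearMap.range g ≤ E := by
    refine hEmax.2 ⟨hBE.trans hErange, fun K hK hKB => ?_⟩ hErange
    have hKE : K ⊓ E = ⊥ := by
      refine hEmax.prop.2 _ inf_le_right ?_
      rw [eq_bot_iff, ← hKB]
      exact inf_le_inf_right _ inf_le_left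
    have hD : K.comap (g ∘ₗ C.mkQ) ≤ C := by
      refine hCmax.2 ?_ ?_
      · change _ ⊓ E = ⊥
        rw [eq_bot_iff, ← hKE]
        rintro x ⟨hx, hxE⟩
        refine ⟨?_, hxE⟩
        have := hg' x hxE
        have hx' : g (C.mkQ x) ∈ K := hx
        rwa [this] at hx'
      · intro x hx
        have h0 : C.mkQ x = 0 := by simpa using hx
        simp [h0]
    rw [eq_bot_iff]
    intro k hk
    obtain ⟨q, rfl⟩ := hK hk
    obtain ⟨d, rfl⟩ := C.mkQ_surjective q
    have h0 : C.mkQ d = 0 := by simpa using hD (show d ∈ K.comap (g ∘ₗ C.mkQ) from hk)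
    simp [h0]
  let r : J →ₗ[R] E := (g ∘ₗ C.mkQ).codRestrict E fun x => hrange ⟨_, rfl⟩
  refine ⟨ModuleCat.of R E, j.codRestrict E fun x => hBE ⟨x, rfl⟩, ⟨⟨?_⟩, ?_, ?_⟩⟩
  · intro X Y _ _ _ _ f hf h
    obtain ⟨h', hh'⟩ := hJ.out f hf (E.subtype ∘ₗ h)
    refine ⟨r ∘ₗ h', fun x => Subtype.ext ?_⟩
    change g (C.mkQ (h' (f x))) = _
    rw [hh']
    exact hg' _ (h x).2
  · intro x y hxy
    exact hjinj (congrArg Subtype.val hxy)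
  · intro N hN
    have h1 : N.map E.subtype = ⊥ := by
      refine hEmax.prop.2 _ (Submodule.map_subtype_le E N) ?_
      rw [eq_bot_iff]
      rintro _ ⟨⟨n, hn, rfl⟩, ⟨a, ha⟩⟩
      have h2 : n ∈ N ⊓ LinearMap.range (j.codRestrict E fun x => hBE ⟨x, rfl⟩) :=
        ⟨hn, ⟨a, Subtype.ext ha⟩⟩
      rw [hN] at h2
      simpa using h2
    rw [eq_bot_iff]
    intro n hn
    have h2 : (n : J) ∈ N.map E.subtype := ⟨n, hn, rfl⟩
    rw [h1] at h2
    exact Subtype.ext h2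

/-- The injective hull `E_R(A)` of an `R`-module `A` (unique up to isomorphism). -/
noncomputable def injectiveHull (A : ModuleCat.{u} R) : ModuleCat.{u} R :=
  (exists_isInjectiveHull A).choose

/-- The embedding `A → E_R(A)`. -/
noncomputable def injectiveHullMap (A : ModuleCat.{u} R) : A →ₗ[R] injectiveHull A :=
  (exists_isInjectiveHull A).choose_spec.choose

theorem injectiveHull_isInjectiveHull (A : ModuleCat.{u} R) :
    IsInjectiveHull (injectiveHullMap A) :=
  (exists_isInjectiveHull A).choose_spec.choose_spec

end InjectiveHull

section Cosupport

variable (R : Type u) [CommRing R]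

/-- The module `⨁_{𝔪 ∈ Max R} E(R/𝔪)`. -/
noncomputable def sumHulls : ModuleCat.{u} R :=
  ModuleCat.of R (DirectSum (MaximalSpectrum R) fun m =>
    injectiveHull (ModuleCat.of R (R ⧸ m.asIdeal)))

variable {R}

/-- The dual `D_R(M) = Hom_R(M, ⨁_𝔪 E(R/𝔪))` of a complex `M` of `R`-modules, formed degreewise:
its component with index `i` is `Hom_R(M_i, ⨁_𝔪 E(R/𝔪))`. The arrows are reversed, so the dual
of a chain complex is a cochain complex and vice versa (that is, `D_R(M)^i = D_R(M)_{-i}` is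
the dual of `M_i`); this is recorded by `ComplexShape.symm`. -/
noncomputable def dual {c : ComplexShape ℤ} (M : HomologicalComplex (ModuleCat.{u} R) c) :
    HomologicalComplex (ModuleCat.{u} R) c.symm :=
  (((linearYoneda R (ModuleCat.{u} R)).obj (sumHulls R)).mapHomologicalComplex c.symm).obj M.op

/-- The localization `S⁻¹M` of a complex of `R`-modules, as a complex of `S⁻¹R`-modules. -/
noncomputable def localize (S : Submonoid R) {c : ComplexShape ℤ}
    (M : HomologicalComplex (ModuleCat.{u} R) c) :
    HomologicalComplex (ModuleCat.{u} (Localization S)) c :=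
  ((ModuleCat.localizedModuleFunctor S).mapHomologicalComplex c).obj M

/-- The co-localization `S₋₁M = D_{S⁻¹R}(S⁻¹ D_R(M))`, a complex of `S⁻¹R`-modules. -/
noncomputable def colocalize (S : Submonoid R) (M : ChainComplex (ModuleCat.{u} R) ℤ) :
    ChainComplex (ModuleCat.{u} (Localization S)) ℤ :=
  dual (localize S (dual M))

/-- The co-localization `ᵖM` of `M` at a prime ideal `𝔭`, that is, relative to `R - 𝔭`. -/
noncomputable abbrev colocalizeAtPrime (p : PrimeSpectrum R)
    (M : ChainComplex (ModuleCat.{u} R) ℤ) :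
    ChainComplex (ModuleCat.{u} (Localization.AtPrime p.asIdeal)) ℤ :=
  colocalize p.asIdeal.primeCompl M

/-- A complex `N` of modules over `S⁻¹R`, regarded as a complex of `R`-modules. -/
noncomputable def restrict (S : Submonoid R)
    (N : ChainComplex (ModuleCat.{u} (Localization S)) ℤ) : ChainComplex (ModuleCat.{u} R) ℤ :=
  ((ModuleCat.restrictScalars (algebraMap R (Localization S))).mapHomologicalComplex _).obj N

/-- The complex `Hom_R(F, G)` of `R`-modules, whose component in cohomological degree `n` is
`∏_p Hom_R(F^p, G^{p+n})`, with differential `α ↦ d ∘ α + (-1)^(n+1) α ∘ d`. -/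
noncomputable def homComplex (F G : CochainComplex (ModuleCat.{u} R) ℤ) :
    CochainComplex (ModuleCat.{u} R) ℤ where
  X n := ModuleCat.of R (CochainComplex.HomComplex.Cochain F G n)
  d i j := ModuleCat.ofHom (CochainComplex.HomComplex.δ_hom R F G i j)
  shape _ _ hij := by ext; simp [CochainComplex.HomComplex.δ_shape _ _ hij]
  d_comp_d' _ _ _ _ _ := by ext; simp [CochainComplex.HomComplex.δ_δ]

/-- `RHom_R(A, X)` for an `R`-module `A` and an unbounded complex `X` of `R`-modules: the complex
`Hom_R(P, X)`, where `P` is a projective resolution of `A`. It is written cohomologically: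
the chain complex `X` is regarded as a cochain complex through `X^n = X_{-n}`. -/
noncomputable def rHom (A : ModuleCat.{u} R) (X : ChainComplex (ModuleCat.{u} R) ℤ) :
    CochainComplex (ModuleCat.{u} R) ℤ :=
  homComplex (projectiveResolution A).cochainComplex
    ((ChainComplex.cochainComplexEquivalence (ModuleCat.{u} R)).functor.obj X)

/-- The big cosupport `coSupp_R M`: the primes `𝔭` with `ᵖM ≄ 0`. A complex is isomorphic to `0`
in the derived category exactly when it is acyclic. -/
def bigCosupport (M : ChainComplex (ModuleCat.{u} R) ℤ) : Set (PrimeSpectrum R) :=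
  {p | ¬ (colocalizeAtPrime p M).Acyclic}

/-- The small cosupport `cosupp_R M`: the primes `𝔭` with `RHom_R(R/𝔭, ᵖM) ≄ 0`. -/
def smallCosupport (M : ChainComplex (ModuleCat.{u} R) ℤ) : Set (PrimeSpectrum R) :=
  {p | ¬ (rHom (ModuleCat.of R (R ⧸ p.asIdeal)) (restrict _ (colocalizeAtPrime p M))).Acyclic}

end Cosupport

end Cosupport

/-! The inclusion holds because `Hom(P, -)` preserves acyclicity when `P` is K-projective: if `ᵖM`
is acyclic, so is `RHom(R/𝔭, ᵖM)`.

For equality, put `L = D_R(M)_𝔭` and `X = ᵖM`, the dual of `L` over `R_𝔭`. With finitely many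
maximal ideals `⨁ E(R/𝔪)` is injective, so duality commutes with homology, as localization does.
Hence `H_i(L)` is the localized dual of `H_i(M)`, and `H_i(X)` is the dual of `H_i(L)`. By the
Matlis-type result `finite_hom_of_isArtinian`, `H_i(L)` is finite over `R_𝔭`.

If `X` is not acyclic, boundedness gives a greatest `s` with `H_s(X) ≠ 0`. The nonzero finite module
`H_s(L)` has a simple quotient, which embeds in the hull of the residue field. This is a nonzero
element of `H_s(X)` killed by `𝔭` (`exists_hom_sumHulls_ne_zero`). Since `s` is the top degree, the
element survives in the homology of `RHom(R/𝔭, X)` (`not_acyclic_homComplex_projectiveResolution`).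
-/

namespace Cosupport

/-! ### Finiteness over adically complete rings -/

section AdicComplete

variable {R : Type*} [CommRing R]

theorem isPrecomplete_pi {ι : Type*} [Finite ι] (I : Ideal R) [IsPrecomplete I R] :
    IsPrecomplete I (ι → R) := by
  classical
  cases nonempty_fintype ι
  refine ⟨fun f hf => ?_⟩
  have hmap (k : ℕ) (i : ι) {x y : ι → R} (h : x ≡ y [SMOD (I ^ k • ⊤ : Submodule R (ι → R))]) :
      x i ≡ y i [SMOD (I ^ k • ⊤ : Submodule R R)] := by
    rw [SModEq.sub_mem] at h ⊢
    have h1 := Submodule.mem_map_of_mem (f := LinearMap.proj (R := R) (φ := fun _ : ι => R) i) h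
    rw [Submodule.map_smul''] at h1
    exact Submodule.smul_mono le_rfl le_top h1
  choose L hL using fun i => IsPrecomplete.prec' (I := I) (M := R) (fun n => f n i)
    fun {m n} hmn => hmap m i (hf hmn)
  refine ⟨L, fun n => ?_⟩
  rw [SModEq.sub_mem, pi_eq_sum_univ' (f n - L)]
  refine Submodule.sum_mem _ fun i _ => ?_
  refine Submodule.smul_mem_smul ?_ trivial
  have := hL i n
  rw [SModEq.sub_mem] at this
  simpa using this

/-- A separated module over a complete ring is finite if it is finite modulo the ideal. -/
theorem finite_of_isAdicComplete {M : Type*} [AddCommGroup M] [Module R M] (I : Ideal R)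
    [IsPrecomplete I R] [IsHausdorff I M] [Module.Finite R (M ⧸ (I • ⊤ : Submodule R M))] :
    Module.Finite R M := by
  obtain ⟨n, g, hg⟩ := Module.Finite.exists_fin' R (M ⧸ (I • ⊤ : Submodule R M))
  obtain ⟨f, hf⟩ := Module.projective_lifting_property (I • ⊤ : Submodule R M).mkQ g
    (Submodule.mkQ_surjective _)
  have := isPrecomplete_pi (ι := Fin n) I
  exact Module.Finite.of_surjective f
    (surjective_of_mkQ_comp_surjective (I := I) (f := f) (hf ▸ hg))

end AdicComplete

/-! ### Artinian modules over semi-local noetherian rings -/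

section Artinian

variable {R : Type*} [CommRing R]

theorem isSemisimpleRing_quotient_jacobson [Finite (MaximalSpectrum R)] :
    IsSemisimpleRing (R ⧸ Ring.jacobson R) := by
  have h : Ring.jacobson R = ⨅ m : MaximalSpectrum R, m.asIdeal := by
    rw [Ring.jacobson_eq_sInf_isMaximal]
    refine le_antisymm (le_iInf fun m => sInf_le m.isMaximal)
      (le_sInf fun I hI => iInf_le (fun m : MaximalSpectrum R => m.asIdeal) ⟨I, hI⟩)
  have (m : MaximalSpectrum R) : IsSemisimpleRing (R ⧸ m.asIdeal) :=
    let _ := Ideal.Quotient.field m.asIdeal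
    inferInstance
  rw [h]
  exact (Ideal.quotientInfRingEquivPiQuotient _ fun m n hmn =>
    Ideal.isCoprime_of_isMaximal fun h => hmn (MaximalSpectrum.ext h)).symm.isSemisimpleRing

/-- The descending chain `Iⁿx` stabilizes, and Nakayama makes its stable value zero. -/
theorem exists_pow_smul_eq_zero [IsNoetherianRing R] {H : Type*} [AddCommGroup H] [Module R H]
    [IsArtinian R H] {I : Ideal R} (hI : I ≤ Ideal.jacobson ⊥) (x : H) :
    ∃ n : ℕ, ∀ r ∈ I ^ n, r • x = 0 := by
  let f : ℕ →o (Submodule R H)ᵒᵈ :=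
    ⟨fun n => OrderDual.toDual (I ^ n • Submodule.span R {x}), fun a b hab =>
      Submodule.smul_mono_left (Ideal.pow_le_pow_right hab)⟩
  obtain ⟨n, hn⟩ := IsArtinian.monotone_stabilizes f
  have h1 : I ^ n • Submodule.span R {x} = I ^ (n + 1) • Submodule.span R {x} :=
    congrArg OrderDual.ofDual (hn (n + 1) n.le_succ)
  have h2 : I ^ n • Submodule.span R {x} = ⊥ := by
    refine Submodule.eq_bot_of_le_smul_of_le_jacobson_bot I _ ?_ ?_ hI
    · exact Submodule.FG.smul (IsNoetherian.noetherian _) (Submodule.fg_span_singleton x)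
    · rw [← Submodule.mul_smul, ← pow_succ', ← h1]
  refine ⟨n, fun r hr => ?_⟩
  have := Submodule.smul_mem_smul hr (Submodule.mem_span_singleton_self (R := R) x)
  rwa [h2, Submodule.mem_bot] at this

/-- The torsion submodule is a module over the semisimple ring `R/J`, where artinian and noetherian
modules coincide. -/
theorem isFiniteLength_torsionBySet_jacobson [IsNoetherianRing R] [Finite (MaximalSpectrum R)]
    {H : Type*} [AddCommGroup H] [Module R H] [IsArtinian R H] :
    IsFiniteLength R (Submodule.torsionBySet R H (Ring.jacobson R : Set R)) := by
  have := isSemisimpleRing_quotient_jacobson (R := R)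
  set T := Submodule.torsionBySet R H (Ring.jacobson R : Set R)
  have hT : Module.IsTorsionBySet R T (Ring.jacobson R : Set R) :=
    Submodule.torsionBySet_isTorsionBySet _
  let := hT.module
  have : IsScalarTower R (R ⧸ Ring.jacobson R) T := hT.isScalarTower
  have h1 : IsArtinian (R ⧸ Ring.jacobson R) T := isArtinian_of_tower R inferInstance
  have h2 : IsNoetherian (R ⧸ Ring.jacobson R) T :=
    ((IsSemisimpleModule.finite_tfae (R := R ⧸ Ring.jacobson R) (M := T)).out 2 1).1 h1
  have h3 : Module.Finite R T := Module.Finite.trans (R ⧸ Ring.jacobson R) T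
  exact isFiniteLength_iff_isNoetherian_isArtinian.2 ⟨inferInstance, inferInstance⟩

end Artinian

/-! ### Matlis duals of artinian modules -/

section Dual

variable {R : Type u} [CommRing R]

/-- Induction on length: `Hom(M/N, E) → Hom(M, E) → Hom(N, E)` is exact in the middle, so the middle
term is noetherian when the outer ones are. -/
theorem finite_hom_of_isFiniteLength [IsNoetherianRing R] {E : Type u} [AddCommGroup E]
    [Module R E] (hE : ∀ m : Ideal R, m.IsMaximal → Module.Finite R ((R ⧸ m) →ₗ[R] E))
    {H : Type u} [AddCommGroup H] [Module R H] (hH : IsFiniteLength R H) :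
    Module.Finite R (H →ₗ[R] E) := by
  induction hH with
  | of_subsingleton => infer_instance
  | @of_simple_quotient M _ _ N hs _ ih =>
    obtain ⟨I, hI, ⟨e⟩⟩ := isSimpleModule_iff_quot_maximal.1 hs
    have := hE I hI
    have : Module.Finite R ((M ⧸ N) →ₗ[R] E) :=
      Module.Finite.equiv (LinearEquiv.congrLeft E R e.symm)
    have : IsNoetherian R (M →ₗ[R] E) := by
      refine isNoetherian_of_range_eq_ker (LinearMap.lcomp R E N.mkQ)
        (LinearMap.lcomp R E N.subtype) (le_antisymm ?_ fun φ hφ => ?_)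
      · rintro _ ⟨φ, rfl⟩
        ext x
        change φ (N.mkQ x) = 0
        have h : N.mkQ x = 0 := (Submodule.Quotient.mk_eq_zero N).2 x.2
        rw [h, map_zero]
      · refine ⟨N.liftQ φ fun x hx => ?_, ?_⟩
        · exact LinearMap.congr_fun hφ ⟨x, hx⟩
        · ext x
          rfl
    infer_instance

/-- Multiplication by generators of `I` maps `H` to a finite power of `H` with kernel the
`I`-torsion. Thus `φ` factors through the image and, by injectivity of `E`, extends to the whole
power; its components are the coefficients of the generators. -/
theorem mem_smul_top_hom {E H : Type u} [AddCommGroup E] [Module R E] [Module.Injective R E]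
    [AddCommGroup H] [Module R H] {I : Ideal R} (hI : I.FG) {φ : H →ₗ[R] E}
    (hφ : ∀ x ∈ Submodule.torsionBySet R H (I : Set R), φ x = 0) :
    φ ∈ (I • ⊤ : Submodule R (H →ₗ[R] E)) := by
  classical
  obtain ⟨s, rfl⟩ := hI
  let g : H →ₗ[R] (s → H) := LinearMap.pi fun r => r.1 • LinearMap.id
  have hg : LinearMap.ker g ≤ LinearMap.ker φ := by
    intro x hx
    refine hφ x ?_
    rw [← Submodule.torsionBySet_eq_torsionBySet_span, Submodule.mem_torsionBySet_iff]
    exact fun r => congrFun (LinearMap.mem_ker.1 hx) r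
  obtain ⟨ψ, hψ⟩ := Module.Injective.extension_property R _ _ _
    ((LinearMap.ker g).liftQ g le_rfl) (LinearMap.ker_eq_bot.1 (Submodule.ker_liftQ_eq_bot' _ _ rfl))
    ((LinearMap.ker g).liftQ φ hg)
  have hφψ : φ = ∑ r : s, r.1 • (ψ ∘ₗ LinearMap.single R (fun _ : s => H) r) := by
    ext x
    have h1 : φ x = ψ (g x) := (LinearMap.congr_fun hψ (Submodule.Quotient.mk x)).symm
    rw [h1, ← Finset.univ_sum_single (g x), map_sum]
    simp [g, ← LinearMap.map_smul, ← Pi.single_smul]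
  rw [hφψ]
  exact Submodule.sum_mem _ fun r _ => Submodule.smul_mem_smul (Submodule.subset_span r.2) trivial

/-- The dual of an artinian module over a complete semi-local noetherian ring is finite. -/
theorem finite_hom_of_isArtinian [IsNoetherianRing R] [Finite (MaximalSpectrum R)]
    [IsAdicComplete (Ring.jacobson R) R] {E : Type u} [AddCommGroup E] [Module R E]
    [Module.Injective R E]
    (hE : ∀ m : Ideal R, m.IsMaximal → Module.Finite R ((R ⧸ m) →ₗ[R] E))
    {H : Type u} [AddCommGroup H] [Module R H] [IsArtinian R H] :
    Module.Finite R (H →ₗ[R] E) := by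
  set J := Ring.jacobson R with hJ
  have hJ' : J ≤ Ideal.jacobson ⊥ := by
    rw [hJ, Ring.jacobson_eq_sInf_isMaximal]
    simp [Ideal.jacobson]
  have := finite_hom_of_isFiniteLength hE
    (isFiniteLength_torsionBySet_jacobson (R := R) (H := H))
  -- Separated because each `x` is killed by some `Jⁿ`, on which a map in `Jⁿ Hom(H, E)` must
  -- vanish.
  have hHaus : IsHausdorff J (H →ₗ[R] E) := by
    refine ⟨fun φ hφ => ?_⟩
    ext x
    obtain ⟨n, hn⟩ := exists_pow_smul_eq_zero hJ' x
    have h1 := hφ n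
    rw [SModEq.zero] at h1
    refine Submodule.smul_induction_on (p := fun φ : H →ₗ[R] E => φ x = 0) h1 ?_ ?_
    · intro r hr ψ _
      rw [LinearMap.smul_apply, ← LinearMap.map_smul, hn r hr, map_zero]
    · intro ψ₁ ψ₂ h₁ h₂
      rw [LinearMap.add_apply, h₁, h₂, add_zero]
  let ρ := LinearMap.lcomp R E (Submodule.torsionBySet R H (J : Set R)).subtype
  -- So `Hom(H, E)/J Hom(H, E)` is a quotient of the image of restriction to the `J`-torsion, which
  -- lies in a finite module.
  have hker : LinearMap.ker ρ ≤ (J • ⊤ : Submodule R (H →ₗ[R] E)) := fun φ hφ =>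
    mem_smul_top_hom (IsNoetherian.noetherian J) fun x hx => LinearMap.congr_fun hφ ⟨x, hx⟩
  have : Module.Finite R ((H →ₗ[R] E) ⧸ LinearMap.ker ρ) :=
    Module.Finite.of_injective ((LinearMap.ker ρ).liftQ ρ le_rfl)
      (LinearMap.ker_eq_bot.1 (Submodule.ker_liftQ_eq_bot' _ _ rfl))
  have : Module.Finite R ((H →ₗ[R] E) ⧸ (J • ⊤ : Submodule R (H →ₗ[R] E))) :=
    Module.Finite.of_surjective (Submodule.factor hker) (Submodule.factor_surjective hker)
  exact finite_of_isAdicComplete J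

/-- The image of a nonzero map `S → E` is simple, so essentiality forces it into the image of `A`.
Hence every such map comes from `Hom(S, A)`. -/
theorem finite_hom_of_isInjectiveHull [IsNoetherianRing R] {S A E : Type u} [AddCommGroup S]
    [Module R S] [AddCommGroup A] [Module R A] [AddCommGroup E] [Module R E]
    [IsSimpleModule R S] [Module.Finite R A] {i : A →ₗ[R] E}
    (hi : IsInjectiveHull i) : Module.Finite R (S →ₗ[R] E) := by
  have hsurj : Function.Surjective (LinearMap.compRight R i : (S →ₗ[R] A) →ₗ[R] S →ₗ[R] E) := by
    intro φ
    by_cases hφ : φ = 0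
    · exact ⟨0, by simp [hφ]⟩
    have hinj : Function.Injective φ := LinearMap.injective_of_ne_zero hφ
    have hsimple : IsSimpleModule R (LinearMap.range φ) :=
      IsSimpleModule.congr (LinearEquiv.ofInjective φ hinj).symm
    have hle : LinearMap.range φ ≤ LinearMap.range i := by
      have h1 : LinearMap.range φ ⊓ LinearMap.range i ≠ ⊥ := fun h =>
        hφ (LinearMap.range_eq_bot.1 (hi.essential _ h))
      have hat : IsAtom (LinearMap.range φ) := isSimpleModule_iff_isAtom.1 hsimple
      exact inf_eq_left.1 ((hat.le_iff.1 inf_le_left).resolve_left h1)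
    let e := LinearEquiv.ofInjective i hi.injective
    refine ⟨e.symm.toLinearMap ∘ₗ φ.codRestrict _ fun x => hle ⟨x, rfl⟩, ?_⟩
    ext x
    exact congrArg Subtype.val (e.apply_symm_apply (φ.codRestrict _ (fun x => hle ⟨x, rfl⟩) x))
  exact Module.Finite.of_surjective _ hsurj

/-- A finite direct sum is a product, and products of injectives are injective. -/
theorem injective_sumHulls [Finite (MaximalSpectrum R)] : Module.Injective R (sumHulls R) := by
  classical
  cases nonempty_fintype (MaximalSpectrum R)
  have (m : MaximalSpectrum R) :
      Module.Injective R (injectiveHull (ModuleCat.of R (R ⧸ m.asIdeal))) :=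
    (injectiveHull_isInjectiveHull _).injective_module
  have h := Module.Injective.pi R fun m : MaximalSpectrum R =>
      injectiveHull (ModuleCat.of R (R ⧸ m.asIdeal))
  exact Module.Baer.injective (Module.Baer.of_equiv
    (DirectSum.linearEquivFunOnFintype R (MaximalSpectrum R) _).symm (Module.Baer.of_injective h))

theorem finite_hom_sumHulls [IsNoetherianRing R] [Finite (MaximalSpectrum R)] (m : Ideal R)
    [m.IsMaximal] : Module.Finite R ((R ⧸ m) →ₗ[R] sumHulls R) := by
  classical
  cases nonempty_fintype (MaximalSpectrum R)
  have : IsSimpleModule R (R ⧸ m) := isSimpleModule_iff_quot_maximal.2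
    ⟨m, inferInstance, ⟨LinearEquiv.refl _ _⟩⟩
  have (n : MaximalSpectrum R) :
      Module.Finite R ((R ⧸ m) →ₗ[R] injectiveHull (ModuleCat.of R (R ⧸ n.asIdeal))) :=
    finite_hom_of_isInjectiveHull (A := R ⧸ n.asIdeal)
      (injectiveHull_isInjectiveHull (ModuleCat.of R (R ⧸ n.asIdeal)))
  let e : sumHulls R ≃ₗ[R] ((n : MaximalSpectrum R) →
      injectiveHull (ModuleCat.of R (R ⧸ n.asIdeal))) :=
    DirectSum.linearEquivFunOnFintype R (MaximalSpectrum R) _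
  let ρ : ((R ⧸ m) →ₗ[R] sumHulls R) →ₗ[R] ((n : MaximalSpectrum R) →
      (R ⧸ m) →ₗ[R] injectiveHull (ModuleCat.of R (R ⧸ n.asIdeal))) :=
    LinearMap.pi fun n => LinearMap.compRight R (LinearMap.proj n ∘ₗ e.toLinearMap)
  refine Module.Finite.of_injective ρ fun φ ψ h => LinearMap.ext fun x => e.injective ?_
  ext n
  exact LinearMap.congr_fun (congrFun h n) x

/-- Over any ring, the module `⨁_𝔪 E(R/𝔪)` receives from each nonzero finite module a nonzero
map whose image is killed by a maximal ideal. -/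
theorem exists_hom_sumHulls_ne_zero (L : Type u) [AddCommGroup L] [Module R L]
    [Module.Finite R L] [Nontrivial L] : ∃ m : Ideal R, m.IsMaximal ∧
      ∃ φ : L →ₗ[R] sumHulls R, φ ≠ 0 ∧ ∀ r ∈ m, r • φ = 0 := by
  classical
  obtain ⟨N, hN⟩ := IsCoatomic.exists_coatom (Submodule R L)
  obtain ⟨m, hm, ⟨e⟩⟩ := isSimpleModule_iff_quot_maximal.1 (isSimpleModule_iff_isCoatom.2 hN)
  let i : (R ⧸ m) →ₗ[R] injectiveHull (ModuleCat.of R (R ⧸ m)) :=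
    injectiveHullMap (ModuleCat.of R (R ⧸ m))
  have hi : Function.Injective i := 
    (injectiveHull_isInjectiveHull (ModuleCat.of R (R ⧸ m))).injective
  let j : injectiveHull (ModuleCat.of R (R ⧸ m)) →ₗ[R] sumHulls R :=
    DirectSum.lof R (MaximalSpectrum R)
      (fun m => injectiveHull (ModuleCat.of R (R ⧸ m.asIdeal))) ⟨m, hm⟩
  have hj : Function.Injective j := DirectSum.of_injective (β := fun m : MaximalSpectrum R =>
    injectiveHull (ModuleCat.of R (R ⧸ m.asIdeal))) ⟨m, hm⟩
  refine ⟨m, hm, j ∘ₗ i ∘ₗ e.toLinearMap ∘ₗ N.mkQ, fun h => hN.1 ?_, fun r hr => ?_⟩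
  · rw [eq_top_iff]
    intro x _
    have h1 : j (i (e (N.mkQ x))) = 0 := LinearMap.congr_fun h x
    rw [map_eq_zero_iff j hj, map_eq_zero_iff i hi, e.map_eq_zero_iff] at h1
    simpa using h1
  · ext x
    have h1 : r • e (N.mkQ x) = 0 := by
      obtain ⟨y, hy⟩ := Submodule.mkQ_surjective m (e (N.mkQ x))
      rw [← hy, ← map_smul, Submodule.mkQ_apply, Submodule.Quotient.mk_eq_zero]
      exact m.mul_mem_right y hr
    change r • j (i (e (N.mkQ x))) = 0
    rw [← map_smul, ← map_smul, h1, map_zero, map_zero]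

end Dual

/-! ### Homology of duals and localizations -/

section Homology

variable {R : Type u} [CommRing R]

theorem preservesHomology_linearYoneda (E : ModuleCat.{u} R) [Injective E] :
    ((linearYoneda R (ModuleCat.{u} R)).obj E).PreservesHomology := by
  refine ((Functor.exact_tfae ((linearYoneda R (ModuleCat.{u} R)).obj E)).out 1 2).1
    fun S hS => ?_
  rw [ShortComplex.moduleCat_exact_iff]
  intro (f : S.unop.X₂ ⟶ E) hf
  exact ⟨hS.unop.descToInjective f hf, hS.unop.comp_descToInjective f hf⟩

/-- If `⨁_𝔪 E(R/𝔪)` is injective, duality commutes with homology. -/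
noncomputable def dualHomologyIso [Injective (sumHulls R)] {c : ComplexShape ℤ}
    (M : HomologicalComplex (ModuleCat.{u} R) c) (i : ℤ) :
    (dual M).homology i ≅
      ((linearYoneda R (ModuleCat.{u} R)).obj (sumHulls R)).obj (Opposite.op (M.homology i)) :=
  haveI := preservesHomology_linearYoneda (sumHulls R)
  (M.op.sc i).mapHomologyIso ((linearYoneda R (ModuleCat.{u} R)).obj (sumHulls R)) ≪≫
    ((linearYoneda R (ModuleCat.{u} R)).obj (sumHulls R)).mapIso (M.homologyOp i)

/-- Localization commutes with homology. -/
noncomputable def localizeHomologyIso (S : Submonoid R) {c : ComplexShape ℤ}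
    (M : HomologicalComplex (ModuleCat.{u} R) c) (i : ℤ) :
    (localize S M).homology i ≅ (ModuleCat.localizedModuleFunctor S).obj (M.homology i) :=
  (M.sc i).mapHomologyIso (ModuleCat.localizedModuleFunctor S)

theorem injective_object_sumHulls [Finite (MaximalSpectrum R)] : Injective (sumHulls R) := by
  have := injective_sumHulls (R := R)
  exact Module.injective_object_of_injective_module R (sumHulls R)

theorem finite_homology_localize_dual [IsNoetherianRing R] [Finite (MaximalSpectrum R)]
    [IsAdicComplete (Ring.jacobson R) R] (S : Submonoid R)
    (M : ChainComplex (ModuleCat.{u} R) ℤ) (i : ℤ) [IsArtinian R (M.homology i)] :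
    Module.Finite (Localization S) ((localize S (dual M)).homology i) := by
  have := injective_sumHulls (R := R)
  have := injective_object_sumHulls (R := R)
  have h1 : Module.Finite R (M.homology i →ₗ[R] sumHulls R) :=
    finite_hom_of_isArtinian fun m _ => finite_hom_sumHulls m
  have h2 : Module.Finite R ((dual M).homology i) :=
    Module.Finite.equiv ((ModuleCat.homLinearEquiv (S := R)).symm.trans
      (dualHomologyIso M i).symm.toLinearEquiv)
  have h3 : Module.Finite (Localization S) (((dual M).homology i).localizedModule S) :=
    Module.Finite.of_isLocalizedModule S (((dual M).homology i).localizedModuleMkLinearMap S)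
  let e : (localize S (dual M)).homology i ≃ₗ[Localization S]
    ((dual M).homology i).localizedModule S := (localizeHomologyIso S (dual M) i).toLinearEquiv
  exact Module.Finite.equiv e.symm

theorem isZero_homology_localize_dual [Finite (MaximalSpectrum R)] (S : Submonoid R)
    (M : ChainComplex (ModuleCat.{u} R) ℤ) {i : ℤ} (h : Limits.IsZero (M.homology i)) :
    Limits.IsZero ((localize S (dual M)).homology i) := by
  have := injective_object_sumHulls (R := R)
  refine Limits.IsZero.of_iso ?_ (localizeHomologyIso S (dual M) i)
  refine Functor.map_isZero _ (Limits.IsZero.of_iso ?_ (dualHomologyIso M i))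
  exact Functor.map_isZero _ h.op

/-- An element of a homology module which is killed by an ideal is represented by a cycle whose
multiples by elements of the ideal are boundaries. -/
theorem exists_cycle_of_homology (S : ShortComplex (ModuleCat.{u} R)) (I : Ideal R)
    (h : S.homology) (h0 : h ≠ 0) (hI : ∀ r ∈ I, r • h = 0) :
    ∃ y : S.X₂, S.g y = 0 ∧ y ∉ LinearMap.range S.f.hom ∧
      ∀ r ∈ I, r • y ∈ LinearMap.range S.f.hom := by
  let e : S.homology ≃ₗ[R] LinearMap.ker S.g.hom ⧸ LinearMap.range S.moduleCatToCycles :=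
    S.moduleCatHomologyIso.toLinearEquiv
  obtain ⟨⟨y, hy⟩, hye⟩ := Submodule.mkQ_surjective _ (e h)
  -- Applied to `r ∈ I`, and to `r = 1` to see that `y` is not a boundary.
  have key (r : R) : r • h = 0 ↔ r • y ∈ LinearMap.range S.f.hom := by
    rw [← e.map_eq_zero_iff, map_smul, ← hye, ← map_smul, Submodule.mkQ_apply]
    refine (Submodule.Quotient.mk_eq_zero _).trans ⟨?_, ?_⟩
    · rintro ⟨x, hx⟩
      exact ⟨x, congrArg Subtype.val hx⟩
    · rintro ⟨x, hx⟩
      exact ⟨x, Subtype.ext hx⟩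
  refine ⟨y, hy, fun hmem => h0 ?_, fun r hr => (key r).1 (hI r hr)⟩
  have := (key 1).2 (by rwa [one_smul])
  rwa [one_smul] at this

end Homology

/-! ### Hom complexes out of K-projective complexes -/

section HomComplex

open CochainComplex CochainComplex.HomComplex

variable {R : Type u} [CommRing R]

/-- A degree `n` cocycle is a chain map `P ⟶ K⟦n⟧`; it is null-homotopic because the target is
acyclic, and a null-homotopy exhibits it as a coboundary. -/
theorem exists_δ_eq_of_acyclic {C : Type*} [Category* C] [Abelian C]
    {P K : CochainComplex C ℤ} [P.IsKProjective]
    (hK : K.Acyclic) {m n : ℤ} (hmn : m + 1 = n) (z : Cochain P K n) (hz : δ n (n + 1) z = 0) :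
    ∃ w : Cochain P K m, δ m n w = z := by
  have hK' : (K⟦n⟧).Acyclic := by
    rw [← HomotopyCategory.quotient_obj_mem_subcategoryAcyclic_iff_acyclic] at hK ⊢
    exact ObjectProperty.prop_of_iso _
      (((HomotopyCategory.quotient C (.up ℤ)).commShiftIso n).symm.app K)
      ((HomotopyCategory.subcategoryAcyclic C).le_shift n _ hK)
  let c : Cocycle P K n := Cocycle.mk z (n + 1) rfl hz
  have h : c ∈ coboundaries P K n := by
    rw [← CohomologyClass.toHom_mk_eq_zero_iff, CohomologyClass.toHom_mk,
      HomotopyCategory.eq_of_homotopy _ 0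
      (IsKProjective.homotopyZero (Cocycle.equivHomShift.symm c) hK'), Functor.map_zero]
  rw [mem_coboundaries_iff _ _ hmn] at h
  exact h

theorem homComplex_acyclic {P K : CochainComplex (ModuleCat.{u} R) ℤ} [P.IsKProjective]
    (hK : K.Acyclic) : (homComplex P K).Acyclic := by
  intro n
  rw [HomologicalComplex.exactAt_iff' _ (n - 1) n (n + 1) (by simp) (by simp),
    ShortComplex.moduleCat_exact_iff]
  intro z hz
  exact exists_δ_eq_of_acyclic hK (by lia) z hz

/-- The component in degree `i` of the subcomplex of `Y` which is `Y` in degrees less than `n`,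
consists of the boundaries in degree `n`, and is zero in degrees greater than `n`. -/
noncomputable def boundaryTruncSubmodule (Y : CochainComplex (ModuleCat.{u} R) ℤ) (n i : ℤ) :
    Submodule R (Y.X i) :=
  -- For `i > n` the indices `n - 1` and `i` are not consecutive, so this differential is zero and
  -- its range is `⊥`.
  if i < n then ⊤ else LinearMap.range (Y.d (n - 1) i).hom

theorem d_mem_boundaryTruncSubmodule (Y : CochainComplex (ModuleCat.{u} R) ℤ) (n i j : ℤ)
    (x : boundaryTruncSubmodule Y n i) : Y.d i j x.1 ∈ boundaryTruncSubmodule Y n j := by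
  obtain ⟨x, hx⟩ := x
  by_cases hij : i + 1 = j
  · subst hij
    unfold boundaryTruncSubmodule at hx ⊢
    by_cases h1 : i + 1 < n
    · rw [if_pos h1]
      trivial
    · rw [if_neg h1]
      by_cases h2 : i < n
      · obtain rfl : i = n - 1 := by lia
        exact ⟨x, rfl⟩
      · rw [if_neg h2] at hx
        obtain ⟨w, rfl⟩ := hx
        have h : Y.d i (i + 1) (Y.d (n - 1) i w) = 0 := by
          rw [← ModuleCat.comp_apply, Y.d_comp_d]
          rfl
        exact h ▸ Submodule.zero_mem _
  · have h : Y.d i j x = 0 := by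
      rw [Y.shape i j hij]
      rfl
    exact h ▸ Submodule.zero_mem _

/-- The subcomplex of `Y` with components `boundaryTruncSubmodule Y n i`. -/
noncomputable def boundaryTrunc (Y : CochainComplex (ModuleCat.{u} R) ℤ) (n : ℤ) :
    CochainComplex (ModuleCat.{u} R) ℤ where
  X i := ModuleCat.of R (boundaryTruncSubmodule Y n i)
  d i j := ModuleCat.ofHom <| LinearMap.codRestrict _
    ((Y.d i j).hom ∘ₗ (boundaryTruncSubmodule Y n i).subtype)
    fun x => d_mem_boundaryTruncSubmodule Y n i j x
  shape i j hij := by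
    refine ModuleCat.hom_ext (LinearMap.ext fun x => Subtype.ext ?_)
    change Y.d i j x.1 = 0
    rw [Y.shape i j hij]
    rfl
  d_comp_d' i j k _ _ := by
    refine ModuleCat.hom_ext (LinearMap.ext fun x => Subtype.ext ?_)
    change Y.d j k (Y.d i j x.1) = 0
    rw [← ModuleCat.comp_apply, Y.d_comp_d]
    rfl

/-- The inclusion of `boundaryTrunc Y n` in `Y`. -/
noncomputable def boundaryTruncι (Y : CochainComplex (ModuleCat.{u} R) ℤ) (n : ℤ) :
    boundaryTrunc Y n ⟶ Y where
  f i := ModuleCat.ofHom (boundaryTruncSubmodule Y n i).subtype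

theorem exactAt_iff_forall (K : CochainComplex (ModuleCat.{u} R) ℤ) (i : ℤ) :
    K.ExactAt i ↔ ∀ x : K.X i, K.d i (i + 1) x = 0 → ∃ w, K.d (i - 1) i w = x := by
  rw [HomologicalComplex.exactAt_iff' _ (i - 1) i (i + 1) (by simp) (by simp),
    ShortComplex.moduleCat_exact_iff]
  rfl

theorem boundaryTrunc_acyclic (Y : CochainComplex (ModuleCat.{u} R) ℤ) (n : ℤ)
    (hY : ∀ i < n, Y.ExactAt i) : (boundaryTrunc Y n).Acyclic := by
  intro i
  rw [exactAt_iff_forall]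
  rintro ⟨x, hx⟩ hdx
  have hdx' : Y.d i (i + 1) x = 0 := congrArg Subtype.val hdx
  have hlow (h : i - 1 < n) (w : Y.X (i - 1)) : w ∈ boundaryTruncSubmodule Y n (i - 1) := by
    rw [boundaryTruncSubmodule, if_pos h]
    trivial
  rcases lt_trichotomy i n with h | rfl | h
  · obtain ⟨w, hw⟩ := (exactAt_iff_forall Y i).1 (hY i h) x hdx'
    exact ⟨⟨w, hlow (by lia) w⟩, Subtype.ext hw⟩
  · have hx' := hx
    rw [boundaryTruncSubmodule, if_neg (by lia)] at hx'
    obtain ⟨w, hw⟩ := hx'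
    exact ⟨⟨w, hlow (by lia) w⟩, Subtype.ext hw⟩
  · have hx' := hx
    rw [boundaryTruncSubmodule, if_neg (by lia)] at hx'
    obtain ⟨w, hw⟩ := hx'
    rw [Y.shape _ _ (by simp; lia)] at hw
    exact ⟨0, by rw [map_zero]; exact Subtype.ext hw⟩

/-- If `Y` is exact in degrees less than `n` and `P` is K-projective and concentrated in
nonpositive degrees, then a map `P⁰ → Yⁿ` inducing a map to `Hⁿ(Y)` that kills the boundaries of
`P` is zero on cohomology as soon as `Hom(P, Y)` is exact in degree `n`. -/
theorem mem_range_of_homComplex_exactAt {P Y : CochainComplex (ModuleCat.{u} R) ℤ}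
    [P.IsKProjective] [P.IsStrictlyLE 0] {n : ℤ} (hY : ∀ i < n, Y.ExactAt i)
    (hPY : (homComplex P Y).ExactAt n) (z₀ : P.X 0 ⟶ Y.X n) (hz₀ : z₀ ≫ Y.d n (n + 1) = 0)
    (hz₀' : ∀ x, z₀ (P.d (-1) 0 x) ∈ LinearMap.range (Y.d (n - 1) n).hom) (x : P.X 0) :
    z₀ x ∈ LinearMap.range (Y.d (n - 1) n).hom := by
  have hB : boundaryTruncSubmodule Y n n = LinearMap.range (Y.d (n - 1) n).hom := by
    rw [boundaryTruncSubmodule, if_neg (by lia)]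
  let ι := boundaryTruncι Y n
  have hι (i : ℤ) : Mono (ι.f i) := (ModuleCat.mono_iff_injective _).2 Subtype.val_injective
  let β : P.X (-1) ⟶ (boundaryTrunc Y n).X n := ModuleCat.ofHom
    (LinearMap.codRestrict _ (P.d (-1) 0 ≫ z₀).hom fun x => hB ▸ hz₀' x)
  have hβ : β ≫ ι.f n = P.d (-1) 0 ≫ z₀ := rfl
  let z : Cochain P Y n := Cochain.single z₀ n
  -- The sign is the one in `δ` of a single cochain; the other term of `δ z` vanishes by `hz₀`.
  let b : Cochain P (boundaryTrunc Y n) (n + 1) :=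
    (n + 1).negOnePow • Cochain.single β (n + 1)
  have hz : δ n (n + 1) z = b.comp (Cochain.ofHom ι) (add_zero _) := by
    rw [Cochain.δ_single z₀ n (n + 1) rfl (-1) (n + 1) rfl rfl, hz₀, ← hβ, Cochain.single_zero,
      zero_add, Cochain.units_smul_comp]
    congr 1
    ext1 p q hpq
    rw [Cochain.comp_zero_cochain_v, Cochain.ofHom_v]
    by_cases h : p = -1
    · subst h
      obtain rfl : q = n := by lia
      simp
    · rw [Cochain.single_v_eq_zero _ _ _ _ _ h, Cochain.single_v_eq_zero _ _ _ _ _ h,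
        Limits.zero_comp]
  have hb : δ (n + 1) (n + 1 + 1) b = 0 := by
    have h1 : β ≫ (boundaryTrunc Y n).d n (n + 1) = 0 := by
      rw [← cancel_mono (ι.f (n + 1)), Category.assoc, ← ι.comm, reassoc_of% hβ, hz₀]
      simp
    have h2 : P.d (-2) (-1) ≫ β = 0 := by
      rw [← cancel_mono (ι.f n), Category.assoc, hβ]
      simp
    rw [δ_units_smul, Cochain.δ_single β (n + 1) (n + 1 + 1) rfl (-2) (n + 1) rfl rfl, h1, h2]
    simp
  -- The coboundary of `z` lives in the acyclic truncation, hence bounds there. Correcting `z` by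
  -- `w` gives a cocycle while changing `z₀` only by boundaries of `Y`.
  obtain ⟨w, hw⟩ := exists_δ_eq_of_acyclic (boundaryTrunc_acyclic Y n hY) rfl b hb
  obtain ⟨v, hv⟩ := (exactAt_iff_forall _ n).1 hPY (z - w.comp (Cochain.ofHom ι) (add_zero _)) (by
    change δ n (n + 1) _ = 0
    rw [δ_sub, δ_comp_ofHom, hw, hz, sub_self])
  change Cochain P Y (n - 1) at v
  change δ (n - 1) n v = _ at hv
  -- At `P⁰` the term of `δ v` passing through `P¹ = 0` disappears, so `z₀` is a boundary plus a
  -- value of `w`.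
  have h0 := Cochain.congr_v hv 0 n (zero_add n)
  rw [δ_v (n - 1) n (by lia) v 0 n (zero_add n) (n - 1) 1 (by lia) (by lia),
    (P.isZero_of_isStrictlyLE 0 1).eq_zero_of_src (v.v 1 n _), Limits.comp_zero, smul_zero,
    add_zero, Cochain.sub_v, Cochain.comp_zero_cochain_v, Cochain.ofHom_v,
    eq_sub_iff_add_eq, Cochain.single_v] at h0
  rw [← h0]
  refine Submodule.add_mem _ ⟨_, rfl⟩ ?_
  have := (w.v 0 n (zero_add n) x).2
  exact hB ▸ this

/-- If `Y` is exact in degrees less than `n`, and `Hⁿ(Y)` has a nonzero element killed by the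
ideal `I`, then `RHom(R/I, Y)` has nonzero cohomology in degree `n`. -/
theorem not_acyclic_homComplex_projectiveResolution {I : Ideal R}
    {Y : CochainComplex (ModuleCat.{u} R) ℤ} {n : ℤ} (hY : ∀ i < n, Y.ExactAt i) {y : Y.X n}
    (hy : Y.d n (n + 1) y = 0) (hy' : y ∉ LinearMap.range (Y.d (n - 1) n).hom)
    (hI : ∀ r ∈ I, r • y ∈ LinearMap.range (Y.d (n - 1) n).hom) :
    ¬ (homComplex (projectiveResolution (ModuleCat.of R (R ⧸ I))).cochainComplex Y).Acyclic := by
  intro hac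
  set Q := projectiveResolution (ModuleCat.of R (R ⧸ I))
  have hQ : Q.cochainComplex.IsKProjective := CochainComplex.isKProjective_of_projective _ 0
  let π : Q.cochainComplex.X 0 ⟶ ModuleCat.of R (R ⧸ I) :=
    (Q.cochainComplexXIso 0 0).hom ≫ Q.π.f 0 ≫ (HomologicalComplex.singleObjXSelf _ 0 _).hom
  have hπ : Function.Surjective π := by
    rw [← ModuleCat.epi_iff_surjective]
    infer_instance
  have hdπ : Q.cochainComplex.d (-1) 0 ≫ π = 0 := by
    rw [Q.cochainComplex_d (-1) 0 1 0]
    simp only [π, Category.assoc, Iso.inv_hom_id_assoc]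
    rw [Q.complex_d_comp_π_f_zero_assoc, Limits.zero_comp, Limits.comp_zero]
  set B := LinearMap.range (Y.d (n - 1) n).hom
  let φ : (R ⧸ I) →ₗ[R] Y.X n ⧸ B :=
    I.liftQ (LinearMap.toSpanSingleton R _ (B.mkQ y)) fun r hr => by
      change r • B.mkQ y = 0
      rw [← map_smul]
      exact (Submodule.Quotient.mk_eq_zero B).2 (hI r hr)
  have : Epi (ModuleCat.ofHom B.mkQ) :=
    (ModuleCat.epi_iff_surjective _).2 (Submodule.mkQ_surjective B)
  -- A lift to `Yⁿ` of the map `R/I → Yⁿ/B` sending `1` to the class of `y`.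
  let z₀ : Q.cochainComplex.X 0 ⟶ Y.X n :=
    Projective.factorThru (π ≫ ModuleCat.ofHom φ) (ModuleCat.ofHom B.mkQ)
  have hz₀ (x : Q.cochainComplex.X 0) : B.mkQ (z₀ x) = φ (π x) :=
    congrArg (fun f => f.hom x)
      (Projective.factorThru_comp (π ≫ ModuleCat.ofHom φ) (ModuleCat.ofHom B.mkQ))
  have hBd : B ≤ LinearMap.ker (Y.d n (n + 1)).hom := by
    rintro _ ⟨w, rfl⟩
    change (Y.d (n - 1) n ≫ Y.d n (n + 1)) w = 0
    rw [Y.d_comp_d]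
    rfl
  have key := mem_range_of_homComplex_exactAt hY (hac n) z₀ ?_ ?_
  · obtain ⟨x, hx⟩ := hπ (Submodule.Quotient.mk 1)
    have h1 : B.mkQ (z₀ x) = B.mkQ y := by
      rw [hz₀, hx]
      change (1 : R) • B.mkQ y = _
      rw [one_smul]
    have h2 : B.mkQ (z₀ x) = 0 := (Submodule.Quotient.mk_eq_zero B).2 (key x)
    exact hy' ((Submodule.Quotient.mk_eq_zero B).1 (h1.symm.trans h2))
  · ext x
    obtain ⟨r, hr⟩ := Submodule.mkQ_surjective I (π x)
    have h1 : B.mkQ (z₀ x - r • y) = 0 := by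
      rw [map_sub, hz₀, ← hr, map_smul]
      exact sub_self _
    have h2 : z₀ x - r • y ∈ LinearMap.ker (Y.d n (n + 1)).hom :=
      hBd ((Submodule.Quotient.mk_eq_zero B).1 h1)
    rw [LinearMap.mem_ker, map_sub, map_smul, sub_eq_zero] at h2
    change Y.d n (n + 1) (z₀ x) = 0
    refine h2.trans ?_
    change r • Y.d n (n + 1) y = 0
    rw [hy, smul_zero]
  · intro x
    refine (Submodule.Quotient.mk_eq_zero B).1 ?_
    refine (hz₀ _).trans ?_
    have h1 : π (Q.cochainComplex.d (-1) 0 x) = 0 := congrArg (fun f => f.hom x) hdπ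
    rw [h1, map_zero]

end HomComplex

/-! ### Restriction of scalars and passage to cochain indexing -/

section Restrict

variable {R : Type u} [CommRing R] (S : Submonoid R)
  (X : ChainComplex (ModuleCat.{u} (Localization S)) ℤ)

/-- The complex `X` of modules over `S⁻¹R`, as a cochain complex of `R`-modules. -/
noncomputable abbrev cochainRestrict : CochainComplex (ModuleCat.{u} R) ℤ :=
  (ChainComplex.cochainComplexEquivalence (ModuleCat.{u} R)).functor.obj (restrict S X)

theorem chainComplex_exactAt_neg_iff (i : ℤ) :
    X.ExactAt (-i) ↔ (X.sc' (-(i - 1)) (-i) (-(i + 1))).Exact :=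
  X.exactAt_iff' _ _ _ (by simp; lia) (by simp; lia)

theorem cochainRestrict_exactAt_iff (i : ℤ) :
    (cochainRestrict S X).ExactAt i ↔ X.ExactAt (-i) := by
  rw [exactAt_iff_forall, chainComplex_exactAt_neg_iff, ShortComplex.moduleCat_exact_iff]
  rfl

theorem cochainRestrict_acyclic (hX : X.Acyclic) : (cochainRestrict S X).Acyclic :=
  fun i => (cochainRestrict_exactAt_iff S X i).2 (hX (-i))

/-- A chain complex over `S⁻¹R` that is exact above degree `s` and has a nonzero element of
`H_s` killed by the image of `I` has `RHom_R(R/I, X) ≄ 0`. -/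
theorem not_acyclic_rHom {I : Ideal R} {s : ℤ} (hX : ∀ i, s < i → X.ExactAt i)
    (h : X.homology s) (h0 : h ≠ 0) (hI : ∀ r ∈ I, algebraMap R (Localization S) r • h = 0) :
    ¬ (rHom (ModuleCat.of R (R ⧸ I)) (restrict S X)).Acyclic := by
  obtain ⟨n, rfl⟩ : ∃ n, s = -n := ⟨-s, by simp⟩
  let T := X.sc' (-(n - 1)) (-n) (-(n + 1))
  let e : X.homology (-n) ≃ₗ[Localization S] T.homology :=
    (ShortComplex.homologyMapIso (X.isoSc' (-(n - 1)) (-n) (-(n + 1)) (by simp; lia)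
      (by simp; lia))).toLinearEquiv
  obtain ⟨y, hy, hy', hIy⟩ := exists_cycle_of_homology T (I.map (algebraMap R (Localization S)))
    (e h) (by simpa using h0) (by
      intro r hr
      rw [← map_smul]
      have hle : I.map (algebraMap R (Localization S)) ≤
          LinearMap.ker (LinearMap.toSpanSingleton (Localization S) _ h) :=
        Ideal.map_le_iff_le_comap.2 hI
      rw [show r • h = 0 from hle hr, map_zero])
  -- Restriction of scalars keeps the underlying groups and differentials, so the cycle `y` over
  -- `S⁻¹R` serves unchanged over `R`.
  exact not_acyclic_homComplex_projectiveResolution (Y := cochainRestrict S X) (n := n) (y := y)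
    (fun i hi => (cochainRestrict_exactAt_iff S X i).2 (hX _ (by lia))) hy hy'
    fun r hr => hIy _ (Ideal.mem_map_of_mem _ hr)

end Restrict

/-! ### Comparison of the two cosupports -/

section Cosupport

variable {R : Type u} [CommRing R]

theorem smallCosupport_subset_bigCosupport (M : ChainComplex (ModuleCat.{u} R) ℤ) :
    smallCosupport M ⊆ bigCosupport M := by
  intro p hp hac
  have := CochainComplex.isKProjective_of_projective
    (projectiveResolution (ModuleCat.of R (R ⧸ p.asIdeal))).cochainComplex 0
  exact hp (homComplex_acyclic (cochainRestrict_acyclic _ _ hac))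

theorem bigCosupport_subset_smallCosupport [IsNoetherianRing R] [Finite (MaximalSpectrum R)]
    [IsAdicComplete (Ring.jacobson R) R] (M : ChainComplex (ModuleCat.{u} R) ℤ)
    (hart : ∀ n : ℤ, IsArtinian R (M.homology n))
    {N : ℤ} (hN : ∀ n : ℤ, N < n → Limits.IsZero (M.homology n)) :
    bigCosupport M ⊆ smallCosupport M := by
  intro p hp
  -- `R_𝔭` is local, so over it too the sum of hulls is injective.
  have : Finite (MaximalSpectrum (Localization.AtPrime p.asIdeal)) := inferInstance
  have hinj : Injective (sumHulls (Localization.AtPrime p.asIdeal)) :=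
    injective_object_sumHulls
  set X := colocalizeAtPrime p M
  let L := localize p.asIdeal.primeCompl (dual M)
  let F := (linearYoneda (Localization.AtPrime p.asIdeal)
    (ModuleCat.{u} (Localization.AtPrime p.asIdeal))).obj (sumHulls _)
  let e (i : ℤ) : X.homology i ≅ F.obj (Opposite.op (L.homology i)) := dualHomologyIso L i
  have hzero (i : ℤ) (h : Limits.IsZero (L.homology i)) : X.ExactAt i := by
    rw [HomologicalComplex.exactAt_iff_isZero_homology]
    exact Limits.IsZero.of_iso (F.map_isZero h.op) (e i)
  have hne : ∃ i, ¬ X.ExactAt i := by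
    by_contra! h
    exact hp h
  obtain ⟨s, hs, hmax⟩ := Int.exists_greatest_of_bdd (P := fun i => ¬ X.ExactAt i)
    ⟨N, fun i hi => by
    by_contra! hlt
    exact hi (hzero i (isZero_homology_localize_dual _ M (hN i hlt)))⟩ hne
  have hfin : Module.Finite (Localization.AtPrime p.asIdeal) (L.homology s) :=
    finite_homology_localize_dual _ M s
  have hnt : Nontrivial (L.homology s) := by
    by_contra h
    rw [not_nontrivial_iff_subsingleton] at h
    exact hs (hzero s (ModuleCat.isZero_of_subsingleton _))
  obtain ⟨m, hm, φ, hφ, hmφ⟩ := exists_hom_sumHulls_ne_zero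
    (R := Localization.AtPrime p.asIdeal) (L.homology s)
  -- The maximal ideal killing `φ` can only be that of the local ring `R_𝔭`, whose preimage is `𝔭`.
  have hpm : p.asIdeal ≤ m.comap (algebraMap R (Localization.AtPrime p.asIdeal)) := by
    rw [IsLocalRing.eq_maximalIdeal hm]
    exact (IsLocalization.AtPrime.under_maximalIdeal _ p.asIdeal).ge
  let ε : (L.homology s →ₗ[Localization.AtPrime p.asIdeal]
      sumHulls (Localization.AtPrime p.asIdeal)) ≃ₗ[Localization.AtPrime p.asIdeal]
      X.homology s :=
    (ModuleCat.homLinearEquiv (S := Localization.AtPrime p.asIdeal)).symm.trans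
      (e s).symm.toLinearEquiv
  refine not_acyclic_rHom _ X (s := s) (fun i hi => ?_) (ε φ) (by simpa using hφ) fun r hr => ?_
  · by_contra h
    exact absurd (hmax i h) (by lia)
  · rw [← map_smul, hmφ _ (hpm hr), map_zero]

end Cosupport

end Cosupport

theorem proposition4p2 {R : Type u} [CommRing R] [IsNoetherianRing R]
    (M : ChainComplex (ModuleCat.{u} R) ℤ) :
    Cosupport.smallCosupport M ⊆ Cosupport.bigCosupport M ∧
      (Finite (MaximalSpectrum R) → IsAdicComplete (Ring.jacobson R) R →
        (∀ n : ℤ, IsArtinian R (M.homology n)) →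
        (∃ N : ℤ, ∀ n : ℤ, N < n → Limits.IsZero (M.homology n)) →
        Cosupport.smallCosupport M = Cosupport.bigCosupport M) := by
  refine ⟨Cosupport.smallCosupport_subset_bigCosupport M, fun _ _ hart ⟨N, hN⟩ => ?_⟩
  exact Set.Subset.antisymm (Cosupport.smallCosupport_subset_bigCosupport M)
    (Cosupport.bigCosupport_subset_smallCosupport M hart hN)
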